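/- Let $A\in\mathbb R^{n\times n}$, $B\in\mathbb R^{n\times m}$, $C\in\mathbb R^{k\times n}$, $D\in\mathbb R^{k\times m}$, $C_z\in\mathbb R^{\bar k\times n}$ be such that $(C,A)$ is detectable, $(A,B)$ is controllable, $BD^\top=0$ and $DD^\top$ is invertible. Consider the plant $\dot x=Ax+Bw$, $y=Cx+Dw$, the observer $\dot{\hat x}=A\hat x+L(\hat y-y)$, $\hat y=C\hat x$, with gain $L\in\mathbb R^{n\times k}$, and the observer error output $z=C_z(x-\hat x)$. In terms of $e=x-\hat x$, the closed-loop error system with input $w$ and output $z$ is $$\mathcal S_L:\quad \dot e=(A+LC)e+(B+LD)w,\qquad z=C_z e .$$ A system is called stable if all eigenvalues of its state matrix have strictly negative real parts. For a system $\mathcal S:\ \dot x=\mathsf Ax+\mathsf Bu,\ y=\mathsf Cx$ and $\alpha>0$ such that all eigenvalues of $\mathsf A$ have real part less than $-\alpha/2$, the $\varepsilon(\alpha)$-norm is defined by $\|\mathcal S\|_{\varepsilon(\alpha)}=\sqrt{\operatorname{tr}(\mathsf C\mathsf P\mathsf C^\top)}$, where $\mathsf P\succ0$ is the (unique) positive definite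 solution of $\mathsf A\mathsf P+\mathsf P\mathsf A^\top+\alpha\mathsf P+\frac1\alpha\mathsf B\mathsf B^\top=0$ (the norm is defined when such a solution exists). Theorem. Let $\alpha>0$ and let $P_\alpha\succ0$ be a positive definite solution of the Riccati equation $$AP_\alpha+P_\alpha A^\top+\alpha P_\alpha-\alpha P_\alpha C^\top(DD^\top)^{-1}CP_\alpha+\tfrac1\alpha BB^\top=0 .$$ Then, with the gain $L=-\alpha P_\alpha C^\top(DD^\top)^{-1}$, the system $\mathcal S_L$ is stable, its $\varepsilon(\alpha)$-norm is defined and equals $$\|\mathcal S_L\|_{\varepsilon(\alpha)}=\sqrt{\operatorname{tr}(C_zP_\alpha C_z^\top)},$$ and this is the smallest value of $\|\mathcal S_{L'}\|_{\varepsilon(\alpha)}$ over all gains $L'\in\mathbb R^{n\times k}$ for which the $\varepsilon(\alpha)$-norm of $\mathcal S_{L'}$ is defined. -/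

import Mathlib

open Matrix

/-- A strictly proper linear time-invariant system `ẋ = A x + B u`, `y = C x`. -/
structure LTISystem (n m k : ℕ) where
  A : Matrix (Fin n) (Fin n) ℝ
  B : Matrix (Fin n) (Fin m) ℝ
  C : Matrix (Fin k) (Fin n) ℝ

/-- A real square matrix is stable if all its (complex) eigenvalues have negative real part. -/
def IsStableMatrix {n : ℕ} (A : Matrix (Fin n) (Fin n) ℝ) : Prop :=
  ∀ μ ∈ spectrum ℂ (A.map (algebraMap ℝ ℂ)), μ.re < 0

/-- The controllability matrix `[B, A B, …, A ^ (n - 1) B]`. -/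
def controllabilityMatrix {n m : ℕ} (A : Matrix (Fin n) (Fin n) ℝ)
    (B : Matrix (Fin n) (Fin m) ℝ) : Matrix (Fin n) (Fin n × Fin m) ℝ :=
  Matrix.of fun i p => (A ^ (p.1 : ℕ) * B) i p.2

/-- `(A, B)` is (completely) controllable. -/
def IsControllable {n m : ℕ} (A : Matrix (Fin n) (Fin n) ℝ)
    (B : Matrix (Fin n) (Fin m) ℝ) : Prop :=
  (controllabilityMatrix A B).rank = n

/-- `(C, A)` is detectable: some output injection makes `A` stable. -/
def IsDetectable {n k : ℕ} (C : Matrix (Fin k) (Fin n) ℝ)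
    (A : Matrix (Fin n) (Fin n) ℝ) : Prop :=
  ∃ L : Matrix (Fin n) (Fin k) ℝ, IsStableMatrix (A + L * C)

namespace LTISystem

variable {n m k : ℕ}

/-- A system is stable if its state matrix is. -/
def IsStable (S : LTISystem n m k) : Prop := IsStableMatrix S.A

/-- `α ∈ (0, -2 r)`, where `r` is the largest real part of the eigenvalues of `A`. -/
def IsAdmissible (S : LTISystem n m k) (α : ℝ) : Prop :=
  0 < α ∧ ∀ μ ∈ spectrum ℂ (S.A.map (algebraMap ℝ ℂ)), α < -2 * μ.re

/-- The invariant ellipsoid equation `A P + P Aᵀ + α P + (1 / α) B Bᵀ = 0`. -/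
def EllipsoidEq (S : LTISystem n m k) (α : ℝ) (P : Matrix (Fin n) (Fin n) ℝ) : Prop :=
  S.A * P + P * S.Aᵀ + α • P + (1 / α) • (S.B * S.Bᵀ) = 0

/-- `S.HasEpsNorm α ν`: the `ε(α)`-norm of `S` is defined and is equal to `ν`, that is,
`α` is admissible and `ν = √(tr (C P Cᵀ))`, where `P` is the positive definite solution of the
invariant ellipsoid equation. -/
def HasEpsNorm (S : LTISystem n m k) (α ν : ℝ) : Prop :=
  S.IsAdmissible α ∧
    ∃ P : Matrix (Fin n) (Fin n) ℝ, P.PosDef ∧ S.EllipsoidEq α P ∧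
      ν = Real.sqrt (S.C * P * S.Cᵀ).trace

/-- For an admissible `α` the invariant ellipsoid equation has at most one solution. -/
theorem EllipsoidEq.unique {S : LTISystem n m k} {α : ℝ} (hα : S.IsAdmissible α)
    {P P' : Matrix (Fin n) (Fin n) ℝ} (h : S.EllipsoidEq α P) (h' : S.EllipsoidEq α P') :
    P = P' := by
  rcases isEmpty_or_nonempty (Fin n) with hn | hn
  · exact Subsingleton.elim _ _
  let f : Matrix (Fin n) (Fin n) ℝ →+* Matrix (Fin n) (Fin n) ℂ := (algebraMap ℝ ℂ).mapMatrix
  have hf : Function.Injective f := Matrix.map_injective (algebraMap ℝ ℂ).injective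
  have hR : S.A * (P - P') + (P - P') * S.Aᵀ + α • (P - P') = 0 := by
    have := sub_eq_zero.mpr (h.trans h'.symm)
    rw [← this, mul_sub, sub_mul, smul_sub]
    abel
  let A := f S.A
  let X := f (P - P')
  have hX : A * X = X * (-((α : ℂ) • (1 : Matrix (Fin n) (Fin n) ℂ)) - Aᵀ) := by
    have h1 := congrArg f hR
    have h2 : f (α • (P - P')) = (α : ℂ) • X := by
      ext i j
      simp [f, X]
    have h3 : f S.Aᵀ = Aᵀ := by
      ext i j
      simp [f, A]
    rw [map_add, map_add, map_mul, map_mul, map_zero, h2, h3] at h1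
    rw [mul_sub, mul_neg, mul_smul_comm, mul_one]
    have h4 : A * X - (-((α : ℂ) • X) - X * Aᵀ) = A * X + X * Aᵀ + (α : ℂ) • X := by abel
    exact sub_eq_zero.mp (h4.trans h1)
  let G := -((α : ℂ) • (1 : Matrix (Fin n) (Fin n) ℂ)) - Aᵀ
  have hpow : ∀ i : ℕ, A ^ i * X = X * G ^ i := by
    intro i
    induction i with
    | zero => simp
    | succ i ih => rw [pow_succ, mul_assoc, hX, ← mul_assoc, ih, mul_assoc, ← pow_succ]
  have hpoly : ∀ p : Polynomial ℂ, Polynomial.aeval A p * X = X * Polynomial.aeval G p := by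
    intro p
    rw [Polynomial.aeval_eq_sum_range, Polynomial.aeval_eq_sum_range, Finset.sum_mul,
      Finset.mul_sum]
    exact Finset.sum_congr rfl fun i _ => by rw [smul_mul_assoc, hpow, mul_smul_comm]
  have hzero := hpoly A.charpoly
  rw [Matrix.aeval_self_charpoly, zero_mul] at hzero
  have hunit : IsUnit (Polynomial.aeval G A.charpoly) := by
    by_contra hc
    rw [← spectrum.zero_mem_iff ℂ, spectrum.map_polynomial_aeval_of_degree_pos] at hc
    · obtain ⟨μ, hμ, hroot⟩ := hc
      have h1 : μ ∈ spectrum ℂ A := Matrix.mem_spectrum_iff_isRoot_charpoly.mpr hroot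
      have h2 : -(α : ℂ) - μ ∈ spectrum ℂ A := by
        rw [spectrum.mem_iff] at hμ ⊢
        intro hu
        apply hμ
        have : algebraMap ℂ (Matrix (Fin n) (Fin n) ℂ) μ - G
            = -(algebraMap ℂ (Matrix (Fin n) (Fin n) ℂ) (-(α : ℂ) - μ) - A)ᵀ := by
          simp only [G, Algebra.algebraMap_eq_smul_one, transpose_sub, transpose_smul,
            transpose_one]
          module
        rw [this]
        exact (((Matrix.isUnit_iff_isUnit_det _).mpr
          ((Matrix.isUnit_det_transpose _) ((Matrix.isUnit_iff_isUnit_det _).mp hu)))).neg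
      have e1 := hα.2 _ h1
      have e2 := hα.2 _ h2
      simp at e1 e2
      linarith
    · rw [Matrix.charpoly_degree_eq_dim]
      simpa using Fin.pos_iff_nonempty.mpr hn
  have hX0 : X = 0 := by
    rcases hunit with ⟨u, hu⟩
    rw [← hu] at hzero
    exact (Units.mul_left_eq_zero u).mp hzero.symm
  have := (map_eq_zero_iff f hf).mp hX0
  exact sub_eq_zero.mp this

/-- The `ε(α)`-norm is well defined. -/
theorem HasEpsNorm.unique {S : LTISystem n m k} {α ν ν' : ℝ} (h : S.HasEpsNorm α ν)
    (h' : S.HasEpsNorm α ν') : ν = ν' := by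
  obtain ⟨hα, P, -, hP, rfl⟩ := h
  obtain ⟨-, P', -, hP', rfl⟩ := h'
  rw [hP.unique hα hP']

end LTISystem

/-- The closed-loop error system, with input `w` and output `z`, of the plant `ẋ = A x + B w`,
`y = C x + D w`, the observer `x̂' = A x̂ + L (ŷ - y)`, `ŷ = C x̂`, and `z = Cz (x - x̂)`,
in the state `e = x - x̂`. -/
def errorSystem {n m k l : ℕ} (A : Matrix (Fin n) (Fin n) ℝ) (B : Matrix (Fin n) (Fin m) ℝ)
    (C : Matrix (Fin k) (Fin n) ℝ) (D : Matrix (Fin k) (Fin m) ℝ)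
    (Cz : Matrix (Fin l) (Fin n) ℝ) (L : Matrix (Fin n) (Fin k) ℝ) : LTISystem n m l where
  A := A + L * C
  B := B + L * D
  C := Cz

/-- The observer error obeys the state equation of `errorSystem`. -/
theorem errorSystem_hasDerivAt {n m k l : ℕ} (A : Matrix (Fin n) (Fin n) ℝ)
    (B : Matrix (Fin n) (Fin m) ℝ) (C : Matrix (Fin k) (Fin n) ℝ)
    (D : Matrix (Fin k) (Fin m) ℝ) (Cz : Matrix (Fin l) (Fin n) ℝ)
    (L : Matrix (Fin n) (Fin k) ℝ) (x xh : ℝ → Fin n → ℝ) (w : ℝ → Fin m → ℝ)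
    (y yh : ℝ → Fin k → ℝ) (t : ℝ)
    (hx : HasDerivAt x (A *ᵥ x t + B *ᵥ w t) t) (hy : y t = C *ᵥ x t + D *ᵥ w t)
    (hxh : HasDerivAt xh (A *ᵥ xh t + L *ᵥ (yh t - y t)) t) (hyh : yh t = C *ᵥ xh t) :
    HasDerivAt (fun s => x s - xh s)
      ((errorSystem A B C D Cz L).A *ᵥ (x t - xh t) + (errorSystem A B C D Cz L).B *ᵥ w t) t := by
  have h := hx.sub hxh
  refine h.congr_deriv ?_
  rw [hy, hyh]
  simp only [errorSystem, add_mulVec, mulVec_sub, mulVec_add, ← mulVec_mulVec]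
  abel

/-! The proof completes the square in the Riccati equation. Put `F = A + L' * C` and `G = B + L' *
D`. Because `B * Dᵀ = 0`, for every gain `L'` `F P + P Fᵀ + α P = (1/α) (L' - L) D Dᵀ (L' - L)ᵀ -
(1/α) G Gᵀ` (`lyapunov_of_riccati`). For `L' = L` the square vanishes, so `P` solves the ellipsoid
equation of the optimal system. Pairing that equation with a left eigenvector `u` for `μ` gives `(2
Re μ + α) u*Pu = -(1/α) |Gᵀ u|²`. The right side is nonzero by controllability, so `Re μ < -α/2`:
this is admissibility of `α`, and stability follows.

If `P'` solves the ellipsoid equation for another admissible `L'`, subtraction shows that `P' - P`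
solves the Lyapunov equation whose right side is minus the square. The comparison principle gives `P
≤ P'`, and the trace is monotone.

The comparison principle (`posSemidef_of_lyapunov`) is proved without the integral formula. If a
solution `X` is not positive semidefinite, subtracting its least generalized eigenvalue `t < 0`
relative to a positive definite solution leaves a singular positive semidefinite matrix. The kernel
of that matrix contains an eigenvector of `Mᴴ`, whose eigenvalue must be purely imaginary, against
stability. -/

namespace Matrix

open scoped ComplexOrder MatrixOrder

variable {ι κ m : Type*}

/-! ### Complexification of real matrices -/

/-- A real matrix viewed as a complex matrix. -/
noncomputable def complexify (X : Matrix m κ ℝ) : Matrix m κ ℂ := X.map (algebraMap ℝ ℂ)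

theorem complexify_add (X Y : Matrix m κ ℝ) :
    (X + Y).complexify = X.complexify + Y.complexify := by
  ext i j
  simp [complexify]

theorem complexify_mul [Fintype κ] (X : Matrix m κ ℝ) (Y : Matrix κ ι ℝ) :
    (X * Y).complexify = X.complexify * Y.complexify :=
  Matrix.map_mul

theorem complexify_smul (c : ℝ) (X : Matrix m κ ℝ) :
    (c • X).complexify = (c : ℂ) • X.complexify := by
  ext i j
  simp [complexify]

theorem complexify_neg (X : Matrix m κ ℝ) : (-X).complexify = -X.complexify := by
  ext i j
  simp [complexify]

theorem complexify_conjTranspose (X : Matrix m κ ℝ) : X.complexifyᴴ = Xᵀ.complexify := by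
  ext i j
  simp [complexify]

theorem complexify_one [DecidableEq ι] : (1 : Matrix ι ι ℝ).complexify = 1 := by
  ext i j
  simp [complexify, one_apply, apply_ite]

theorem complexify_isHermitian {X : Matrix ι ι ℝ} (hX : X.IsHermitian) :
    X.complexify.IsHermitian := by
  rw [IsHermitian, complexify_conjTranspose, ← conjTranspose_eq_transpose_of_trivial, hX]

theorem PosSemidef.complexify [Fintype ι] {X : Matrix ι ι ℝ} (hX : X.PosSemidef) :
    X.complexify.PosSemidef := by
  classical
  -- A factorization `Yᵀ * Y` survives complexification as `Yᴴ * Y`.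
  obtain ⟨Y, rfl⟩ := CStarAlgebra.nonneg_iff_eq_star_mul_self.mp hX.nonneg
  rw [star_eq_conjTranspose, complexify_mul, conjTranspose_eq_transpose_of_trivial,
    ← complexify_conjTranspose]
  exact posSemidef_conjTranspose_mul_self _

theorem isUnit_complexify [Fintype ι] [DecidableEq ι] {X : Matrix ι ι ℝ} (hX : IsUnit X) :
    IsUnit X.complexify :=
  hX.map (algebraMap ℝ ℂ).mapMatrix

theorem PosDef.complexify [Fintype ι] {X : Matrix ι ι ℝ} (hX : X.PosDef) : X.complexify.PosDef := by
  classical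
  exact hX.posSemidef.complexify.posDef_iff_isUnit.mpr (isUnit_complexify hX.isUnit)

theorem PosSemidef.of_complexify [Fintype ι] {X : Matrix ι ι ℝ} (hX : X.complexify.PosSemidef) :
    X.PosSemidef := by
  refine .of_dotProduct_mulVec_nonneg ?_ fun v => ?_
  · ext i j
    have := congrFun (congrFun hX.1 i) j
    simpa [Matrix.complexify] using this
  · have h := hX.dotProduct_mulVec_nonneg (fun i => (v i : ℂ))
    have e : star (fun i => (v i : ℂ)) ⬝ᵥ (X.complexify *ᵥ fun i => (v i : ℂ))
        = ((star v ⬝ᵥ (X *ᵥ v) : ℝ) : ℂ) := by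
      simp [dotProduct, mulVec, Matrix.complexify]
    rw [e] at h
    exact_mod_cast h

/-! ### Lyapunov equations -/

variable [Fintype ι]

/-- The complex conjugates of the eigenvalues of `M` are the eigenvalues of `Mᴴ`. -/
theorem mem_spectrum_iff_exists_conjTranspose_mulVec [DecidableEq ι] {M : Matrix ι ι ℂ} {c : ℂ} :
    c ∈ spectrum ℂ M ↔ ∃ u ≠ 0, Mᴴ *ᵥ u = star c • u := by
  rw [spectrum.mem_iff, isUnit_iff_isUnit_det, isUnit_iff_ne_zero, not_not,
    ← exists_vecMul_eq_zero_iff]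
  have key : ∀ v : ι → ℂ, v ᵥ* (algebraMap ℂ (Matrix ι ι ℂ) c - M) = 0 ↔
      Mᴴ *ᵥ star v = star c • star v := by
    intro v
    rw [vecMul_sub, Algebra.algebraMap_eq_smul_one, vecMul_smul, vecMul_one, sub_eq_zero,
      ← star_vecMul, ← star_smul, star_inj, eq_comm]
  constructor
  · rintro ⟨v, hv, h⟩
    exact ⟨star v, by simpa using hv, (key v).mp h⟩
  · rintro ⟨u, hu, h⟩
    exact ⟨star u, by simpa using hu, (key _).mpr (by simpa using h)⟩

/-- The quadratic form of a solution of a Lyapunov equation at an eigenvector. -/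
theorem star_dotProduct_mulVec_of_lyapunov {M X Q : Matrix ι ι ℂ} (h : M * X + X * Mᴴ = -Q)
    {u : ι → ℂ} {c : ℂ} (hu : Mᴴ *ᵥ u = c • u) :
    ((2 * c.re : ℝ) : ℂ) * (star u ⬝ᵥ (X *ᵥ u)) = -(star u ⬝ᵥ (Q *ᵥ u)) := by
  have h1 : star u ⬝ᵥ ((M * X + X * Mᴴ) *ᵥ u) = (star c + c) * (star u ⬝ᵥ (X *ᵥ u)) := by
    rw [add_mulVec, dotProduct_add, ← mulVec_mulVec, ← mulVec_mulVec, hu, mulVec_smul,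
      dotProduct_smul, dotProduct_mulVec (star u) M, ← conjTranspose_conjTranspose M,
      ← star_mulVec, hu, star_smul, smul_dotProduct]
    simp only [smul_eq_mul]
    ring
  have h2 : ((2 * c.re : ℝ) : ℂ) = star c + c := by
    apply Complex.ext
    · simp; ring
    · simp
  rw [h2, ← h1, h, neg_mulVec, dotProduct_neg]

/-- The least generalized eigenvalue of a Hermitian matrix relative to a positive definite one. -/
theorem exists_posSemidef_sub_smul [Nonempty ι] {X P : Matrix ι ι ℂ} (hX : X.IsHermitian)
    (hP : P.PosDef) :
    ∃ (t : ℝ) (v : ι → ℂ), v ≠ 0 ∧ (X - (t : ℂ) • P).PosSemidef ∧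
      (X - (t : ℂ) • P) *ᵥ v = 0 := by
  let q : Matrix ι ι ℂ → (ι → ℂ) → ℝ := fun Y v => (star v ⬝ᵥ (Y *ᵥ v)).re
  have hq : ∀ Y, Continuous (q Y) := fun Y => by
    simp only [q, dotProduct, mulVec]
    fun_prop
  have hqs : ∀ (Y : Matrix ι ι ℂ) (r : ℝ) (v : ι → ℂ), q Y ((r : ℂ) • v) = r ^ 2 * q Y v := by
    intro Y r v
    simp only [q, mulVec_smul, star_smul, smul_dotProduct, dotProduct_smul, smul_eq_mul]
    simp
    ring
  have hpos : ∀ v : ι → ℂ, v ≠ 0 → 0 < q P v := fun v hv => hP.re_dotProduct_pos hv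
  have hne : ∀ v ∈ Metric.sphere (0 : ι → ℂ) 1, v ≠ 0 := fun v hv =>
    ne_zero_of_mem_unit_sphere ⟨v, hv⟩
  -- Minimize the Rayleigh quotient. It is invariant under real scaling, so the sphere of the sup
  -- norm serves as well as the Euclidean one.
  obtain ⟨v₀, hv₀, hmin⟩ := (isCompact_sphere (0 : ι → ℂ) 1).exists_isMinOn
    (NormedSpace.sphere_nonempty.mpr zero_le_one)
    ((hq X).continuousOn.div (hq P).continuousOn fun v hv => (hpos v (hne v hv)).ne')
  let t := q X v₀ / q P v₀
  have hqsub : ∀ v, q (X - (t : ℂ) • P) v = q X v - t * q P v := by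
    intro v
    simp [q, sub_mulVec, dotProduct_sub, smul_mulVec, dotProduct_smul]
  have hH : (X - (t : ℂ) • P).IsHermitian := by
    refine hX.sub ?_
    rw [IsHermitian, conjTranspose_smul, hP.1]
    simp
  have hval : ∀ v, star v ⬝ᵥ ((X - (t : ℂ) • P) *ᵥ v) = ((q (X - (t : ℂ) • P) v : ℝ) : ℂ) :=
    fun v => Complex.ext rfl (by simpa using hH.im_star_dotProduct_mulVec_self v)
  have hpsd : (X - (t : ℂ) • P).PosSemidef := by
    refine .of_dotProduct_mulVec_nonneg hH fun v => ?_
    rw [hval]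
    refine Complex.zero_le_real.mpr ?_
    by_cases hv : v = 0
    · simp [hv, q]
    have hn : (‖v‖ : ℝ) ≠ 0 := norm_ne_zero_iff.mpr hv
    let w : ι → ℂ := ((‖v‖⁻¹ : ℝ) : ℂ) • v
    have hw : w ∈ Metric.sphere (0 : ι → ℂ) 1 := by
      simp [w, norm_smul, hn]
    have hvw : v = ((‖v‖ : ℝ) : ℂ) • w := by
      simp [w, smul_smul, hn]
    have h1 : t ≤ q X w / q P w := hmin hw
    rw [le_div_iff₀ (hpos w (hne w hw))] at h1
    rw [hvw, hqs, hqsub]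
    exact mul_nonneg (sq_nonneg _) (sub_nonneg.mpr h1)
  refine ⟨t, v₀, hne v₀ hv₀, hpsd, (hpsd.dotProduct_mulVec_zero_iff v₀).mp ?_⟩
  rw [hval, hqsub, div_mul_cancel₀ _ (hpos v₀ (hne v₀ hv₀)).ne', sub_self, Complex.ofReal_zero]

/-- If a stable Lyapunov equation with positive semidefinite right-hand side has a positive
definite solution for some right-hand side, then its Hermitian solutions are positive
semidefinite. -/
theorem posSemidef_of_lyapunov {M X P Q R : Matrix ι ι ℂ}
    (hM : ∀ (c : ℂ) (u : ι → ℂ), u ≠ 0 → Mᴴ *ᵥ u = c • u → c.re < 0)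
    (hP : P.PosDef) (hR : R.PosSemidef) (hPR : M * P + P * Mᴴ = -R)
    (hX : X.IsHermitian) (hQ : Q.PosSemidef) (hXQ : M * X + X * Mᴴ = -Q) :
    X.PosSemidef := by
  classical
  rcases isEmpty_or_nonempty ι with hι | hι
  · rw [Subsingleton.elim X 0]
    exact .zero
  obtain ⟨t, v, hv, hY, hYv⟩ := exists_posSemidef_sub_smul hX hP
  rcases le_or_gt 0 t with ht | ht
  · have := hY.add (hP.posSemidef.smul (a := (t : ℂ)) (by exact_mod_cast ht))
    simpa using this
  -- Now `t < 0`, so passing from `X` to `Y = X - t P` adds the positive semidefinite term `s • R`,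
  -- `s = -t`, to `Q`.
  exfalso
  let s : ℂ := ((-t : ℝ) : ℂ)
  have hs : 0 ≤ s := by
    simp only [s]
    exact_mod_cast (neg_pos.mpr ht).le
  have hs0 : s ≠ 0 := by
    simp only [s]
    exact_mod_cast (neg_pos.mpr ht).ne'
  let Y := X - (t : ℂ) • P
  replace hY : Y.PosSemidef := hY
  have hYeq : M * Y + Y * Mᴴ = -(Q + s • R) := by
    have e : M * Y + Y * Mᴴ = (M * X + X * Mᴴ) - (t : ℂ) • (M * P + P * Mᴴ) := by
      simp only [Y, mul_sub, sub_mul, mul_smul_comm, smul_mul_assoc, smul_add]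
      abel
    rw [e, hPR, hXQ]
    simp only [s, Complex.ofReal_neg]
    module
  have hsR : (s • R).PosSemidef := hR.smul hs
  -- On the kernel of `Y` both terms of `u*(M Y + Y Mᴴ)u` vanish, and a positive semidefinite matrix
  -- kills every vector at which its form is zero.
  have hker : ∀ u : ι → ℂ, Y *ᵥ u = 0 → (Q + s • R) *ᵥ u = 0 := by
    intro u hu
    refine ((hQ.add hsR).dotProduct_mulVec_zero_iff u).mp ?_
    have h0 : star u ᵥ* Y = 0 := by
      rw [← hY.1, ← star_mulVec, hu, star_zero]
    rw [← neg_eq_zero, ← dotProduct_neg, ← neg_mulVec, ← hYeq, add_mulVec, dotProduct_add,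
      ← mulVec_mulVec, hu, mulVec_zero, ← mulVec_mulVec, dotProduct_mulVec _ Y, h0]
    simp
  -- Applied to `u` in the kernel, the equation for `Y` reduces to `Y Mᴴ u = 0`.
  have hinv : ∀ u ∈ LinearMap.ker Y.mulVecLin, Mᴴ.mulVecLin u ∈ LinearMap.ker Y.mulVecLin := by
    intro u hu
    simp only [LinearMap.mem_ker, mulVecLin_apply] at hu ⊢
    have h1 := congrArg (· *ᵥ u) hYeq
    beta_reduce at h1
    rwa [neg_mulVec, hker u hu, neg_zero, add_mulVec, ← mulVec_mulVec, hu, mulVec_zero, zero_add,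
      ← mulVec_mulVec] at h1
  have hnt : Nontrivial (LinearMap.ker Y.mulVecLin) :=
    ⟨⟨⟨v, hYv⟩, 0, fun h => hv (congrArg Subtype.val h)⟩⟩
  obtain ⟨c, hc⟩ := Module.End.exists_eigenvalue (Mᴴ.mulVecLin.restrict hinv)
  obtain ⟨⟨u, huk⟩, hu⟩ := hc.exists_hasEigenvector
  have hu0 : u ≠ 0 := fun h => hu.2 (Subtype.ext h)
  have hMu : Mᴴ *ᵥ u = c • u := congrArg Subtype.val hu.apply_eq_smul
  have hYu : Y *ᵥ u = 0 := by simpa using huk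
  have hRu : star u ⬝ᵥ (R *ᵥ u) = 0 := by
    have h1 : star u ⬝ᵥ ((Q + s • R) *ᵥ u) = 0 := by rw [hker u hYu, dotProduct_zero]
    rw [add_mulVec, dotProduct_add, add_eq_zero_iff_of_nonneg (hQ.dotProduct_mulVec_nonneg u)
      (hsR.dotProduct_mulVec_nonneg u), smul_mulVec, dotProduct_smul, smul_eq_mul] at h1
    exact (mul_eq_zero.mp h1.2).resolve_left hs0
  -- With `u*Ru = 0`, the equation of `P` forces `2 Re c · u*Pu = 0`.
  have h2 := star_dotProduct_mulVec_of_lyapunov hPR hMu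
  rw [hRu, neg_zero, mul_eq_zero] at h2
  have hPu := (hP.dotProduct_mulVec_pos hu0).ne'
  have h3 := h2.resolve_right hPu
  have h4 := hM c u hu0 hMu
  norm_cast at h3
  linarith

end Matrix
-- Real Lyapunov equations with decay rate `α`
namespace Matrix

variable {ι : Type*} [Fintype ι] [DecidableEq ι]

/-- The shift turning `F X + X Fᵀ + α X` into a complex Lyapunov operator. -/
theorem complexify_lyapunov_shift {F X Q : Matrix ι ι ℝ} {α : ℝ}
    (h : F * X + X * Fᵀ + α • X = -Q) :
    (F + (α / 2) • (1 : Matrix ι ι ℝ)).complexify * X.complexify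
      + X.complexify * (F + (α / 2) • (1 : Matrix ι ι ℝ)).complexifyᴴ = -Q.complexify := by
  rw [complexify_conjTranspose, ← complexify_mul, ← complexify_mul, ← complexify_add,
    ← complexify_neg, ← h]
  congr 1
  simp only [transpose_add, transpose_smul, transpose_one, add_mul, mul_add, smul_mul_assoc,
    mul_smul_comm, one_mul, mul_one]
  module

theorem complexify_shift_conjTranspose_mulVec (F : Matrix ι ι ℝ) (α : ℝ) (u : ι → ℂ) :
    (F + (α / 2) • (1 : Matrix ι ι ℝ)).complexifyᴴ *ᵥ u
      = F.complexifyᴴ *ᵥ u + ((α / 2 : ℝ) : ℂ) • u := by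
  rw [complexify_add, complexify_smul, complexify_one, conjTranspose_add, conjTranspose_smul,
    conjTranspose_one, add_mulVec, smul_mulVec, one_mulVec]
  simp

/-- Comparison principle for the shifted Lyapunov equation `F X + X Fᵀ + α X = -Q`. -/
theorem posSemidef_of_shifted_lyapunov {F X P Q R : Matrix ι ι ℝ} {α : ℝ}
    (hF : ∀ μ ∈ spectrum ℂ (F.map (algebraMap ℝ ℂ)), α < -2 * μ.re)
    (hP : P.PosDef) (hR : R.PosSemidef) (hPR : F * P + P * Fᵀ + α • P = -R)
    (hX : X.IsHermitian) (hQ : Q.PosSemidef) (hXQ : F * X + X * Fᵀ + α • X = -Q) :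
    X.PosSemidef := by
  refine .of_complexify (posSemidef_of_lyapunov (fun c u hu hc => ?_) hP.complexify hR.complexify
    (complexify_lyapunov_shift hPR) (complexify_isHermitian hX) hQ.complexify
    (complexify_lyapunov_shift hXQ))
  rw [complexify_shift_conjTranspose_mulVec] at hc
  -- The shift moves eigenvalues by `α / 2`, and passing to the adjoint conjugates them.
  have h1 := hF (star (c - ((α / 2 : ℝ) : ℂ)))
    (mem_spectrum_iff_exists_conjTranspose_mulVec.mpr ⟨u, hu, by
      rw [star_star, sub_smul, ← hc, add_sub_cancel_right]; rfl⟩)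
  simp at h1
  linarith

/-- If `F P + P Fᵀ + α P = -R` has a positive definite solution, with `R` positive semidefinite
and not annihilating any left eigenvector of `F`, then all eigenvalues of `F` have real part less
than `-α / 2`. -/
theorem re_lt_of_shifted_lyapunov {F P R : Matrix ι ι ℝ} {α : ℝ} (hP : P.PosDef)
    (hR : R.PosSemidef) (hPR : F * P + P * Fᵀ + α • P = -R)
    (hFR : ∀ (c : ℂ) (u : ι → ℂ), F.complexifyᴴ *ᵥ u = c • u → R.complexify *ᵥ u = 0 → u = 0) :
    ∀ μ ∈ spectrum ℂ (F.map (algebraMap ℝ ℂ)), α < -2 * μ.re := by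
  open scoped ComplexOrder in
  intro μ hμ
  obtain ⟨u, hu, hc⟩ := mem_spectrum_iff_exists_conjTranspose_mulVec.mp hμ
  have hc' : (F + (α / 2) • (1 : Matrix ι ι ℝ)).complexifyᴴ *ᵥ u
      = (star μ + ((α / 2 : ℝ) : ℂ)) • u := by
    rw [complexify_shift_conjTranspose_mulVec, add_smul, ← hc]; rfl
  have h := star_dotProduct_mulVec_of_lyapunov (complexify_lyapunov_shift hPR) hc'
  have hp := hP.complexify.dotProduct_mulVec_pos hu
  have hr : 0 < star u ⬝ᵥ (R.complexify *ᵥ u) := by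
    refine (hR.complexify.dotProduct_mulVec_nonneg u).lt_of_ne' fun h0 => hu ?_
    exact hFR _ u hc ((hR.complexify.dotProduct_mulVec_zero_iff u).mp h0)
  have h' := congrArg Complex.re h
  rw [Complex.re_ofReal_mul, Complex.neg_re] at h'
  have hp' := (Complex.pos_iff.mp hp).1
  have hr' := (Complex.pos_iff.mp hr).1
  have h2 : 2 * (star μ + ((α / 2 : ℝ) : ℂ)).re < 0 := by
    by_contra! hn
    have := mul_nonneg hn hp'.le
    linarith
  simp at h2
  linarith

end Matrix

/-! ### Controllability and left eigenvectors -/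

/-- The Popov–Belevitch–Hautus test: a left eigenvector of `A` annihilating `B` vanishes when
`(A, B)` is controllable. -/
theorem IsControllable.eq_zero_of_mulVec {n m : ℕ} {A : Matrix (Fin n) (Fin n) ℝ}
    {B : Matrix (Fin n) (Fin m) ℝ} (h : IsControllable A B) {c : ℂ} {u : Fin n → ℂ}
    (hA : Aᵀ.complexify *ᵥ u = c • u) (hB : Bᵀ.complexify *ᵥ u = 0) : u = 0 := by
  let K := controllabilityMatrix A B
  have hpow : ∀ i : ℕ, (Aᵀ ^ i).complexify *ᵥ u = c ^ i • u := by
    intro i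
    induction i with
    | zero => simp [complexify_one]
    | succ i ih =>
      rw [pow_succ, complexify_mul, ← mulVec_mulVec, hA, mulVec_smul, ih, smul_smul, pow_succ,
        mul_comm]
  have hK : Kᵀ.complexify *ᵥ u = 0 := by
    ext p
    have h1 : (A ^ (p.1 : ℕ) * B)ᵀ.complexify *ᵥ u = 0 := by
      rw [transpose_mul, transpose_pow, complexify_mul, ← mulVec_mulVec, hpow, mulVec_smul, hB,
        smul_zero]
    exact congrFun h1 p.2
  -- Full row rank makes the Gram matrix `K * Kᵀ` invertible, so `Kᵀ` has trivial kernel, over `ℂ`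
  -- as well.
  have hunit : IsUnit (K * Kᵀ) := by
    rw [← linearIndependent_rows_iff_isUnit, linearIndependent_iff_card_eq_finrank_span,
      Set.finrank, ← rank_eq_finrank_span_row, rank_self_mul_transpose, Fintype.card_fin]
    exact h.symm
  have h2 : (K * Kᵀ).complexify *ᵥ u = 0 := by
    rw [complexify_mul, ← mulVec_mulVec, hK, mulVec_zero]
  exact mulVec_injective_iff_isUnit.mpr (isUnit_complexify hunit) (h2.trans (mulVec_zero _).symm)

/-! ### Completion of squares and the error system -/

section ErrorSystem

variable {n m k : ℕ} {A P : Matrix (Fin n) (Fin n) ℝ} {B : Matrix (Fin n) (Fin m) ℝ}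
  {C : Matrix (Fin k) (Fin n) ℝ} {D : Matrix (Fin k) (Fin m) ℝ} {α : ℝ}

theorem add_mul_mul_transpose_of_mul_transpose_eq_zero (hBD : B * Dᵀ = 0)
    (L : Matrix (Fin n) (Fin k) ℝ) :
    (B + L * D) * (B + L * D)ᵀ = B * Bᵀ + L * (D * Dᵀ) * Lᵀ := by
  have hDB : D * Bᵀ = 0 := by simpa using congrArg transpose hBD
  have h1 : B * (Dᵀ * Lᵀ) = 0 := by rw [← Matrix.mul_assoc, hBD, Matrix.zero_mul]
  have h2 : L * D * Bᵀ = 0 := by rw [Matrix.mul_assoc, hDB, Matrix.mul_zero]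
  rw [transpose_add, transpose_mul, Matrix.add_mul, Matrix.mul_add, Matrix.mul_add, h1, h2]
  simp only [Matrix.mul_assoc, add_zero, zero_add]

/-- Completion of squares in the Riccati equation. -/
theorem lyapunov_of_riccati (hBD : B * Dᵀ = 0) (hDD : IsUnit (D * Dᵀ)) (hα : α ≠ 0)
    (hP : P.IsHermitian)
    (hRic : A * P + P * Aᵀ + α • P - α • (P * Cᵀ * (D * Dᵀ)⁻¹ * C * P)
      + (1 / α) • (B * Bᵀ) = 0)
    {L : Matrix (Fin n) (Fin k) ℝ} (hL : L = -(α • (P * Cᵀ * (D * Dᵀ)⁻¹)))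
    (L' : Matrix (Fin n) (Fin k) ℝ) :
    (A + L' * C) * P + P * (A + L' * C)ᵀ + α • P
      = (1 / α) • ((L' - L) * (D * Dᵀ) * (L' - L)ᵀ)
        - (1 / α) • ((B + L' * D) * (B + L' * D)ᵀ) := by
  have hPt : Pᵀ = P := by rw [← conjTranspose_eq_transpose_of_trivial]; exact hP
  have hdet := (isUnit_iff_isUnit_det _).mp hDD
  set R := D * Dᵀ with hR
  have hRt : Rᵀ = R := by simp [hR]
  have hLR : L * R = -(α • (P * Cᵀ)) := by
    rw [hL, Matrix.neg_mul, smul_mul, nonsing_inv_mul_cancel_right _ _ hdet]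
  have hRL : R * Lᵀ = -(α • (C * P)) := by
    have := congrArg transpose hLR
    simpa [hRt, hPt] using this
  have hLRL : L * R * Lᵀ = α • (α • (P * Cᵀ * R⁻¹ * C * P)) := by
    rw [Matrix.mul_assoc, hRL, hL]
    simp [Matrix.mul_assoc]
  have hsq : (L' - L) * R * (L' - L)ᵀ = L' * R * L'ᵀ + α • (L' * C * P) + α • (P * Cᵀ * L'ᵀ)
      + α • (α • (P * Cᵀ * R⁻¹ * C * P)) := by
    have e1 : L' * R * Lᵀ = -(α • (L' * C * P)) := by
      rw [Matrix.mul_assoc, hRL]; simp [Matrix.mul_assoc]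
    have e2 : L * R * L'ᵀ = -(α • (P * Cᵀ * L'ᵀ)) := by
      rw [hLR]; simp
    rw [transpose_sub, Matrix.sub_mul, Matrix.sub_mul, Matrix.mul_sub, Matrix.mul_sub, e1, e2, hLRL]
    module
  have hRic' : A * P + P * Aᵀ + α • P = α • (P * Cᵀ * R⁻¹ * C * P) - (1 / α) • (B * Bᵀ) := by
    rw [← sub_eq_zero, ← hRic]; abel
  have hlhs : (A + L' * C) * P + P * (A + L' * C)ᵀ + α • P
      = (A * P + P * Aᵀ + α • P) + L' * C * P + P * Cᵀ * L'ᵀ := by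
    simp only [transpose_add, transpose_mul, Matrix.add_mul, Matrix.mul_add, Matrix.mul_assoc]
    abel
  rw [hlhs, hRic', hsq, add_mul_mul_transpose_of_mul_transpose_eq_zero hBD, ← hR]
  simp only [smul_add, smul_smul, one_div, inv_mul_cancel₀ hα, inv_mul_cancel_left₀ hα, one_smul]
  abel

/-- A left eigenvector of the error dynamics is not annihilated by the input matrix. -/
theorem eq_zero_of_errorSystem_mulVec (hctrl : IsControllable A B) (hBD : B * Dᵀ = 0)
    (hDD : IsUnit (D * Dᵀ)) (L : Matrix (Fin n) (Fin k) ℝ) {c : ℂ} {u : Fin n → ℂ}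
    (hu : (A + L * C)ᵀ.complexify *ᵥ u = c • u) (hB : (B + L * D)ᵀ.complexify *ᵥ u = 0) :
    u = 0 := by
  have hDB : D * Bᵀ = 0 := by simpa using congrArg transpose hBD
  -- Since `D * Bᵀ = 0`, multiplying `(B + L * D)ᵀ u = 0` by `D` isolates `D Dᵀ Lᵀ u`. Once `Lᵀ u =
  -- 0`, the injection terms drop out and `u` is a left eigenvector of `A` annihilating `B`.
  have hL : Lᵀ.complexify *ᵥ u = 0 := by
    have h1 : (D * Dᵀ).complexify *ᵥ (Lᵀ.complexify *ᵥ u) = 0 := by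
      have h2 : D * Dᵀ * Lᵀ = D * (B + L * D)ᵀ := by
        rw [transpose_add, transpose_mul, Matrix.mul_add, hDB, zero_add, Matrix.mul_assoc]
      rw [mulVec_mulVec, ← complexify_mul, h2, complexify_mul, ← mulVec_mulVec, hB, mulVec_zero]
    exact mulVec_injective_iff_isUnit.mpr (isUnit_complexify hDD) (h1.trans (mulVec_zero _).symm)
  rw [transpose_add, transpose_mul, complexify_add, complexify_mul, add_mulVec, ← mulVec_mulVec,
    hL, mulVec_zero, add_zero] at hu hB
  exact hctrl.eq_zero_of_mulVec hu hB

end ErrorSystem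

/-! ### Optimality of the Riccati gain -/

theorem mainTheorem3 {n m k l : ℕ}
    (A : Matrix (Fin n) (Fin n) ℝ) (B : Matrix (Fin n) (Fin m) ℝ)
    (C : Matrix (Fin k) (Fin n) ℝ) (D : Matrix (Fin k) (Fin m) ℝ)
    (Cz : Matrix (Fin l) (Fin n) ℝ)
    (hdet : IsDetectable C A) (hctrl : IsControllable A B)
    (hBD : B * Dᵀ = 0) (hDD : IsUnit (D * Dᵀ))
    (α : ℝ) (hα : 0 < α)
    (P : Matrix (Fin n) (Fin n) ℝ) (hP : P.PosDef)
    (hRic : A * P + P * Aᵀ + α • P - α • (P * Cᵀ * (D * Dᵀ)⁻¹ * C * P)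
      + (1 / α) • (B * Bᵀ) = 0)
    (L : Matrix (Fin n) (Fin k) ℝ) (hL : L = -(α • (P * Cᵀ * (D * Dᵀ)⁻¹))) :
    (errorSystem A B C D Cz L).IsStable ∧
    (errorSystem A B C D Cz L).HasEpsNorm α (Real.sqrt (Cz * P * Czᵀ).trace) ∧
    IsLeast {ν : ℝ | ∃ L' : Matrix (Fin n) (Fin k) ℝ,
        (errorSystem A B C D Cz L').HasEpsNorm α ν}
      (Real.sqrt (Cz * P * Czᵀ).trace) := by
  have hric := lyapunov_of_riccati hBD hDD hα.ne' hP.1 hRic hL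
  have hα' : 0 ≤ 1 / α := (one_div_pos.mpr hα).le
  have hpsd : ∀ L' : Matrix (Fin n) (Fin k) ℝ,
      ((1 / α) • ((B + L' * D) * (B + L' * D)ᵀ)).PosSemidef := fun L' => by
    rw [← conjTranspose_eq_transpose_of_trivial]
    exact (posSemidef_self_mul_conjTranspose _).smul hα'
  have hLP : (A + L * C) * P + P * (A + L * C)ᵀ + α • P
      = -((1 / α) • ((B + L * D) * (B + L * D)ᵀ)) := by
    rw [hric L, sub_self, Matrix.zero_mul, Matrix.zero_mul, smul_zero, zero_sub]
  have hspec : ∀ μ ∈ spectrum ℂ ((A + L * C).map (algebraMap ℝ ℂ)), α < -2 * μ.re := by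
    refine re_lt_of_shifted_lyapunov hP (hpsd L) hLP fun c u hu hR => ?_
    rw [complexify_conjTranspose] at hu
    refine eq_zero_of_errorSystem_mulVec hctrl hBD hDD L hu ?_
    open scoped ComplexOrder in
    rw [complexify_smul, smul_mulVec, complexify_mul, ← complexify_conjTranspose,
      smul_eq_zero_iff_right (by exact_mod_cast (one_div_pos.mpr hα).ne'),
      self_mul_conjTranspose_mulVec_eq_zero] at hR
    rw [← complexify_conjTranspose, hR]
  have hnorm : (errorSystem A B C D Cz L).HasEpsNorm α (Real.sqrt (Cz * P * Czᵀ).trace) := by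
    refine ⟨⟨hα, hspec⟩, P, hP, ?_, rfl⟩
    exact add_eq_zero_iff_eq_neg.mpr hLP
  refine ⟨fun μ hμ => ?_, hnorm, ⟨L, hnorm⟩, ?_⟩
  · have := hspec μ hμ
    linarith
  rintro ν ⟨L', ⟨-, hspec'⟩, P', hP', hE, rfl⟩
  have hP'eq : (A + L' * C) * P' + P' * (A + L' * C)ᵀ + α • P'
      = -((1 / α) • ((B + L' * D) * (B + L' * D)ᵀ)) := add_eq_zero_iff_eq_neg.mp hE
  have hQ : ((1 / α) • ((L' - L) * (D * Dᵀ) * (L' - L)ᵀ)).PosSemidef := by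
    rw [← conjTranspose_eq_transpose_of_trivial D, ← conjTranspose_eq_transpose_of_trivial (L' - L)]
    exact ((posSemidef_self_mul_conjTranspose D).mul_mul_conjTranspose_same _).smul hα'
  have hdiff : (P' - P).PosSemidef := by
    -- `P'` itself is the positive definite reference solution required by the comparison principle.
    refine posSemidef_of_shifted_lyapunov hspec' hP' (hpsd L') hP'eq (hP'.1.sub hP.1) hQ ?_
    change (A + L' * C) * (P' - P) + (P' - P) * (A + L' * C)ᵀ + α • (P' - P) = _
    have h1 : (A + L' * C) * (P' - P) + (P' - P) * (A + L' * C)ᵀ + α • (P' - P)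
        = ((A + L' * C) * P' + P' * (A + L' * C)ᵀ + α • P')
          - ((A + L' * C) * P + P * (A + L' * C)ᵀ + α • P) := by
      rw [Matrix.mul_sub, Matrix.sub_mul, smul_sub]
      abel
    rw [h1, hP'eq, hric L']
    abel
  have htr := (hdiff.mul_mul_conjTranspose_same Cz).trace_nonneg
  rw [conjTranspose_eq_transpose_of_trivial, Matrix.mul_sub, Matrix.sub_mul, trace_sub,
    sub_nonneg] at htr
  exact Real.sqrt_le_sqrt htr
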